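/- Notation. For positive integers $n, a_1,\dots,a_n$ and an integer $N \le \sum_{i=1}^n a_i$, put $\mathfrak m(a_1,\dots,a_n;N)=1$ if $N<n$, and, if $n\le N\le\sum_{i=1}^n a_i$, let $\mathfrak m(a_1,\dots,a_n;N)$ be the minimum of $\prod_{i=1}^n y_i$ over all $(y_1,\dots,y_n)\in\mathbb Z^n$ with $1\le y_i\le a_i$ for all $i$ and $\sum_{i=1}^n y_i=N$. For an ideal $I$ of a commutative ring, a subset $B$ and an element $x$ of that ring, "$x\in B \pmod I$" means that there is $b\in B$ with $x-b\in I$. Degrees of polynomials are total degrees, and the zero polynomial is given degree $0$. Theorem 1.5. Let $(\mathfrak r,\mathfrak p)$ be a finite commutative local ring with maximal ideal $\mathfrak p$ in which every ideal is principal. Let $v$ be its length, i.e. the positive integer with $\mathfrak p^{v-1}\ne(0)$ and $\mathfrak p^v=(0)$, and let $q=\#(\mathfrak r/\mathfrak p)$. Let $n,r\in\mathbb Z^+$, and let $v_1,\dots,v_r$ be integers with $1\le v_j\le v$. Let $\mathfrak a_1,\dots,\mathfrak a_n,\mathfrak b_1,\dots,\mathfrak b_r\subset\mathfrak r$ be nonempty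 subsets, each having the property that no two distinct elements are congruent modulo $\mathfrak p$. Let $f_1,\dots,f_r\in\mathfrak r[t_1,\dots,t_n]$, and let $$\mathfrak z=\Big\{x\in\prod_{i=1}^n\mathfrak a_i \;\Big|\; f_j(x)\in\mathfrak b_j \pmod{\mathfrak p^{v_j}}\text{ for all }1\le j\le r\Big\}.$$ Then $\mathfrak z=\varnothing$ or $$\#\mathfrak z\ \ge\ \mathfrak m\Big(\#\mathfrak a_1,\dots,\#\mathfrak a_n;\ \sum_{i=1}^n\#\mathfrak a_i-\sum_{j=1}^r\big(q^{v_j}-\#\mathfrak b_j\big)\deg f_j\Big).$$ -/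

import Mathlib

/-- The quantity `𝔪(a₁, …, aₙ; N)`: it is `1` if `N < n`, and for `n ≤ N ≤ ∑ aᵢ` it is the
minimum of `∏ yᵢ` over the integer vectors `y` with `1 ≤ yᵢ ≤ aᵢ` and `∑ yᵢ = N`
(in that range such `y` exist when all `aᵢ ≥ 1`, so `sInf` is a true minimum). -/
noncomputable def frakM {n : ℕ} (a : Fin n → ℕ) (N : ℤ) : ℕ :=
  if N < (n : ℤ) then 1
  else sInf {m : ℕ | ∃ y : Fin n → ℕ,
    (∀ i, 1 ≤ y i ∧ y i ≤ a i) ∧ ∑ i, (y i : ℤ) = N ∧ m = ∏ i, y i}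

/-- `x ∈ B (mod I)`: there is `b ∈ B` with `x - b ∈ I`. -/
def MemMod {R : Type*} [CommRing R] (x : R) (B : Finset R) (I : Ideal R) : Prop :=
  ∃ b ∈ B, x - b ∈ I

/-- No two distinct elements of `A` are congruent modulo `I`. -/
def PairwiseIncongruent {R : Type*} [CommRing R] (A : Finset R) (I : Ideal R) : Prop :=
  ∀ x ∈ A, ∀ y ∈ A, x ≠ y → x - y ∉ I

/-- The set of `x ∈ ∏ Aᵢ` with `fⱼ(x) ∈ Bⱼ (mod 𝔭 ^ wⱼ)` for all `j`, where `𝔭` is the maximal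
ideal of the local ring `R`. -/
def restrictedSolutions {R : Type*} [CommRing R] [IsLocalRing R] {n r : ℕ}
    (A : Fin n → Finset R) (B : Fin r → Finset R) (w : Fin r → ℕ)
    (f : Fin r → MvPolynomial (Fin n) R) : Set (Fin n → R) :=
  {x | (∀ i, x i ∈ A i) ∧
    ∀ j, MemMod (MvPolynomial.eval x (f j)) (B j) (IsLocalRing.maximalIdeal R ^ w j)}

/-! The conditions are turned into the nonvanishing of a single polynomial over the residue field
`k`, to which Alon–Füredi is applied on the reduced grid. Reduction is injective on each `A i`, so
no counts change. For one condition modulo `𝔭 ^ (w + 1)`, choose a section `ρ` of the residue map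
with `B` among its values. At a grid point, `f ∈ B` holds iff `f` reduces into the image of `B` and
`∏ s, (f - ρ s) ∈ 𝔭 ^ (w + 1)`, since only one factor is a nonunit. That product always lies in `𝔭 =
(π)`, so on the grid it equals `π * g` with `deg g ≤ q * deg f` (`exists_eval_eq_mul_eval`).
Cancelling `π` leaves `g ∈ 𝔭 ^ w`, which is handled by induction. The degree factors add up: `(q -
#B) + (q ^ w - 1) * q = q ^ (w + 1) - #B`. -/

namespace MvPolynomial

open Finset

/-! ### Polynomials on grids over a field: division and Alon–Füredi. -/

section Grid

variable {σ k : Type*}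

theorem totalDegree_prod_X_sub_C [CommRing k] [IsDomain k] (S : Finset k) (i : σ) :
    (∏ s ∈ S, (X i - C s : MvPolynomial σ k)).totalDegree = #S := by
  classical
  have hlin (s : k) : (X i - C s : MvPolynomial σ k).totalDegree = 1 := by
    rw [sub_eq_add_neg, ← C_neg, totalDegree_add_eq_left_of_totalDegree_lt]
    · exact totalDegree_X i
    · simp
  have hne (s : k) : (X i - C s : MvPolynomial σ k) ≠ 0 := fun h => by
    simpa [h] using hlin s
  induction S using Finset.induction_on with
  | empty => simp
  | insert a S ha ih =>
    rw [prod_insert ha, totalDegree_mul_of_isDomain (hne a) (prod_ne_zero_iff.2 fun s _ => hne s),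
      hlin, ih, card_insert_of_notMem ha, add_comm]

variable [Fintype σ]

/-- Combinatorial Nullstellensatz with the degree drop made explicit; the alternative `h i = 0` is
needed because the zero polynomial has degree `0`. -/
theorem exists_eq_sum_of_eval_eq_zero_on_grid [Field k] (S : σ → Finset k)
    (hS : ∀ i, (S i).Nonempty) (f : MvPolynomial σ k)
    (hf : ∀ x : σ → k, (∀ i, x i ∈ S i) → eval x f = 0) :
    ∃ h : σ → MvPolynomial σ k,
      (∀ i, h i = 0 ∨ (h i).totalDegree + #(S i) ≤ f.totalDegree) ∧
      f = ∑ i, h i * ∏ s ∈ S i, (X i - C s) := by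
  obtain ⟨h, hdeg, hsum⟩ := combinatorial_nullstellensatz_exists_linearCombination S hS f hf
  refine ⟨h, fun i => or_iff_not_imp_left.2 fun hi => ?_, ?_⟩
  · have hP : (∏ s ∈ S i, (X i - C s : MvPolynomial σ k)) ≠ 0 := fun h0 => by
      have := totalDegree_prod_X_sub_C (S i) i
      rw [h0, totalDegree_zero] at this
      exact (hS i).card_pos.ne this
    have := hdeg i
    rw [totalDegree_mul_of_isDomain hP hi, totalDegree_prod_X_sub_C] at this
    omega
  · conv_lhs => rw [hsum]
    rw [Finsupp.linearCombination_apply, Finsupp.sum_fintype _ _ (by simp)]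
    simp [smul_eq_mul]

/-- A polynomial vanishing on the part of a grid where the `i`-th coordinate lies in `S` is, as a
function on the grid, divisible by `∏ s ∈ S, (X i - C s)`. -/
theorem exists_eval_eq_prod_mul_eval [Field k] [DecidableEq σ] (A : σ → Finset k)
    (hA : ∀ j, (A j).Nonempty) (i : σ) (S : Finset k) (f : MvPolynomial σ k)
    (hf : ∀ x : σ → k, (∀ j, j ≠ i → x j ∈ A j) → x i ∈ S → eval x f = 0) :
    ∃ g : MvPolynomial σ k, (g = 0 ∨ g.totalDegree + #S ≤ f.totalDegree) ∧
      ∀ x : σ → k, (∀ j, j ≠ i → x j ∈ A j) →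
        eval x f = (∏ s ∈ S, (x i - s)) * eval x g := by
  rcases S.eq_empty_or_nonempty with rfl | hS
  · exact ⟨f, by simp⟩
  obtain ⟨h, hdeg, hsum⟩ := exists_eq_sum_of_eval_eq_zero_on_grid (Function.update A i S)
    (fun j => by
      rcases eq_or_ne j i with rfl | hj
      · simpa using hS
      · simpa [hj] using hA j) f
    (fun x hx => hf x (fun j hj => by simpa [hj] using hx j) (by simpa using hx i))
  refine ⟨h i, by simpa using hdeg i, fun x hx => ?_⟩
  -- Each term with `j ≠ i` contains the vanishing factor at `s = x j ∈ A j`, so only the `i`-th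
  -- term survives.
  conv_lhs => rw [hsum]
  rw [map_sum, sum_eq_single i]
  · simp [map_prod, mul_comm]
  · intro j _ hj
    rw [map_mul, map_prod, prod_eq_zero (i := x j), mul_zero]
    · simpa [hj] using hx j hj
    · simp
  · simp

theorem card_filter_piFinset_eq_sum_update [DecidableEq k] [DecidableEq σ] (A : σ → Finset k)
    (p : (σ → k) → Prop) [DecidablePred p] (i : σ) :
    #{x ∈ Fintype.piFinset A | p x} =
      ∑ c ∈ A i, #{x ∈ Fintype.piFinset (Function.update A i {c}) | p x} := by
  rw [card_eq_sum_card_fiberwise (f := fun x => x i) (t := A i)]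
  · refine sum_congr rfl fun c hc => congrArg card ?_
    ext x
    simp only [mem_filter, Fintype.mem_piFinset]
    constructor
    · rintro ⟨⟨hx, hp⟩, rfl⟩
      refine ⟨fun j => ?_, hp⟩
      rcases eq_or_ne j i with rfl | hj
      · simp
      · simpa [hj] using hx j
    · rintro ⟨hx, hp⟩
      have hi : x i = c := by simpa using hx i
      refine ⟨⟨fun j => ?_, hp⟩, hi⟩
      rcases eq_or_ne j i with rfl | hj
      · rwa [hi]
      · simpa [hj] using hx j
  · intro x hx
    exact Fintype.mem_piFinset.1 (mem_filter.1 hx).1 i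

/-- Induction on the coordinates allowed to vary: slicing replaces a side by a singleton, so the set
of variables stays fixed. Values whose slice carries no nonzero are divided out, lowering the degree
by their number; every other slice has at least as many nonzeros as the minimal one. -/
theorem alon_furedi_of_card_eq_one_off [Field k] [DecidableEq k] [DecidableEq σ] (s : Finset σ) :
    ∀ (A : σ → Finset k), (∀ i, (A i).Nonempty) → (∀ i, i ∉ s → #(A i) = 1) →
    ∀ f : MvPolynomial σ k, (∃ x ∈ Fintype.piFinset A, eval x f ≠ 0) →
    ∃ y : σ → ℕ, (∀ i, 1 ≤ y i ∧ y i ≤ #(A i)) ∧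
      ∑ i, #(A i) ≤ f.totalDegree + ∑ i, y i ∧
      ∏ i, y i ≤ #{x ∈ Fintype.piFinset A | eval x f ≠ 0} := by
  induction s using Finset.induction_on with
  | empty =>
    intro A hA h1 f ⟨x, hx, hfx⟩
    refine ⟨1, fun i => ⟨le_rfl, (h1 i (notMem_empty i)).ge⟩, ?_, ?_⟩
    · rw [sum_congr rfl fun i _ => h1 i (notMem_empty i)]
      simp
    · simpa using card_pos.2 ⟨x, mem_filter.2 ⟨hx, hfx⟩⟩
  | insert i s hi ih =>
    intro A hA h1 f ⟨x, hx, hfx⟩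
    rw [Fintype.mem_piFinset] at hx
    let U (c : k) : Finset (σ → k) :=
      {x ∈ Fintype.piFinset (Function.update A i {c}) | eval x f ≠ 0}
    let T : Finset k := {c ∈ A i | (U c).Nonempty}
    have hT : T.Nonempty := by
      refine ⟨x i, mem_filter.2 ⟨hx i, x, mem_filter.2 ⟨Fintype.mem_piFinset.2 fun j => ?_, hfx⟩⟩⟩
      rcases eq_or_ne j i with rfl | hj
      · simp
      · simpa [hj] using hx j
    obtain ⟨c, hcT, hmin⟩ := exists_min_image T (fun c => #(U c)) hT
    obtain ⟨hcA, hcU⟩ := mem_filter.1 hcT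
    obtain ⟨g, hgdeg, hg⟩ := exists_eval_eq_prod_mul_eval A hA i (A i \ T) f (by
      intro z hz hzi
      obtain ⟨hzA, hzT⟩ := mem_sdiff.1 hzi
      by_contra hne
      refine hzT (mem_filter.2 ⟨hzA, z, mem_filter.2 ⟨Fintype.mem_piFinset.2 fun j => ?_, hne⟩⟩)
      rcases eq_or_ne j i with rfl | hj
      · simp
      · simpa [hj] using hz j hj)
    -- As `c ∈ T`, the removed linear factors are nonzero on this slice.
    have hU : U c = {x ∈ Fintype.piFinset (Function.update A i {c}) | eval x g ≠ 0} := by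
      refine filter_congr fun z hz => ?_
      rw [Fintype.mem_piFinset] at hz
      have hzi : z i = c := by simpa using hz i
      rw [hg z fun j hj => by simpa [hj] using hz j, mul_ne_zero_iff, and_iff_right]
      refine prod_ne_zero_iff.2 fun t ht => sub_ne_zero.2 ?_
      rintro rfl
      exact (mem_sdiff.1 ht).2 (hzi ▸ hcT)
    obtain ⟨z, hz⟩ := hcU
    rw [hU, mem_filter] at hz
    obtain ⟨y, hy, hsum, hprod⟩ := ih (Function.update A i {c})
      (fun j => by
        rcases eq_or_ne j i with rfl | hj
        · simp
        · simpa [hj] using hA j)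
      (fun j hj => by
        rcases eq_or_ne j i with rfl | hji
        · simp
        · simpa [hji] using h1 j (by simp [hj, hji]))
      g ⟨z, hz⟩
    have hg0 : g ≠ 0 := by
      rintro rfl
      exact hz.2 (map_zero _)
    have hgdeg := hgdeg.resolve_left hg0
    have hyi : y i = 1 := by have := hy i; simp at this; omega
    have hTA : T ⊆ A i := filter_subset _ _
    have hcard := card_sdiff_add_card_eq_card hTA
    -- On the slice `y i = 1`; the `#T` live slices turn it into `#T`.
    refine ⟨Function.update y i #T, fun j => ?_, ?_, ?_⟩
    · rcases eq_or_ne j i with rfl | hj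
      · simpa using ⟨hT, card_le_card hTA⟩
      · simpa [hj] using hy j
    · have e1 : ∑ j, #(Function.update A i {c} j) = 1 + ∑ j ∈ univ \ {i}, #(A j) := by
        rw [← sum_sdiff (subset_univ {i}), add_comm]
        refine congrArg₂ _ (by simp) (sum_congr rfl fun j hj => ?_)
        simp only [mem_sdiff, mem_singleton] at hj
        simp [hj.2]
      have e2 : ∑ j, y j = y i + ∑ j ∈ univ \ {i}, y j := by
        rw [← sum_sdiff (subset_univ {i}), add_comm, sum_singleton]
      have e3 : ∑ j, #(A j) = #(A i) + ∑ j ∈ univ \ {i}, #(A j) := by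
        rw [← sum_sdiff (subset_univ {i}), add_comm, sum_singleton]
      rw [sum_update_of_mem (mem_univ i)]
      omega
    · have e2 : ∏ j, y j = ∏ j ∈ univ \ {i}, y j := by
        rw [← prod_sdiff (subset_univ {i}), prod_singleton, hyi, mul_one]
      rw [prod_update_of_mem (mem_univ i), ← e2, card_filter_piFinset_eq_sum_update A _ i]
      calc #T * ∏ j, y j ≤ ∑ t ∈ T, #(U t) := by
            rw [← smul_eq_mul]
            exact card_nsmul_le_sum _ _ _ fun t ht => (hprod.trans_eq (by rw [hU])).trans (hmin t ht)
        _ ≤ _ := sum_le_sum_of_subset hTA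

/-- **Alon–Füredi theorem**: a lower bound for the number of points of a finite grid at which a
polynomial that does not vanish identically on the grid is nonzero. -/
theorem alon_furedi [Field k] [DecidableEq k] [DecidableEq σ] (A : σ → Finset k)
    (f : MvPolynomial σ k) (hf : ∃ x ∈ Fintype.piFinset A, eval x f ≠ 0) :
    ∃ y : σ → ℕ, (∀ i, 1 ≤ y i ∧ y i ≤ #(A i)) ∧
      ∑ i, #(A i) ≤ f.totalDegree + ∑ i, y i ∧
      ∏ i, y i ≤ #{x ∈ Fintype.piFinset A | eval x f ≠ 0} := by
  obtain ⟨x, hx, -⟩ := id hf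
  exact alon_furedi_of_card_eq_one_off univ A (fun i => ⟨x i, Fintype.mem_piFinset.1 hx i⟩)
    (by simp) f hf

end Grid

end MvPolynomial

/-! ### Comparison with the minimum `frakM`. -/

theorem exists_le_sum_eq {ι : Type*} [Fintype ι] (y : ι → ℕ) (hy : ∀ i, 1 ≤ y i) (N : ℕ)
    (hN : Fintype.card ι ≤ N) (hNy : N ≤ ∑ i, y i) :
    ∃ z : ι → ℕ, (∀ i, 1 ≤ z i ∧ z i ≤ y i) ∧ ∑ i, z i = N := by
  classical
  induction hm : ∑ i, y i generalizing y with
  | zero => exact ⟨y, fun i => ⟨hy i, le_rfl⟩, by omega⟩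
  | succ m ih =>
    rcases hNy.eq_or_lt with h | h
    · exact ⟨y, fun i => ⟨hy i, le_rfl⟩, h.symm⟩
    have : ∃ i, 1 < y i := by
      by_contra! hle
      have : ∑ i, y i ≤ Finset.univ.card • 1 :=
        Finset.sum_le_card_nsmul Finset.univ y 1 fun i _ => hle i
      rw [smul_eq_mul, mul_one, Finset.card_univ] at this
      omega
    obtain ⟨i, hi⟩ := this
    have hsum : ∑ j, Function.update y i (y i - 1) j = m := by
      rw [Finset.sum_update_of_mem (Finset.mem_univ i)]
      rw [← Finset.sum_sdiff (Finset.subset_univ {i}), Finset.sum_singleton] at hm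
      omega
    have hle (j : ι) : Function.update y i (y i - 1) j ≤ y j := by
      rcases eq_or_ne j i with rfl | hj
      · simp
      · simp [hj]
    obtain ⟨z, hz, hzN⟩ := ih (Function.update y i (y i - 1)) (fun j => by
      rcases eq_or_ne j i with rfl | hj
      · simp; omega
      · simpa [hj] using hy j) (by rw [hsum]; omega) hsum
    exact ⟨z, fun j => ⟨(hz j).1, (hz j).2.trans (hle j)⟩, hzN⟩

/-- Alon–Füredi only bounds `∑ y i` from below; lowering entries until the sum is exactly `N` can
only shrink the product. -/
theorem frakM_le_of_prod_le {n : ℕ} {a y : Fin n → ℕ} {N : ℤ} {m : ℕ}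
    (hy : ∀ i, 1 ≤ y i ∧ y i ≤ a i) (hN : N ≤ ∑ i, (y i : ℤ)) (hm : ∏ i, y i ≤ m) :
    frakM a N ≤ m := by
  unfold frakM
  split_ifs with h
  · exact (Finset.one_le_prod' fun i _ => (hy i).1).trans hm
  · lift N to ℕ using by omega
    obtain ⟨z, hz, hzN⟩ := exists_le_sum_eq y (fun i => (hy i).1) N (by simp; omega)
      (by exact_mod_cast hN)
    have hmem : ∏ i, z i ∈ {m : ℕ | ∃ y : Fin n → ℕ,
        (∀ i, 1 ≤ y i ∧ y i ≤ a i) ∧ ∑ i, (y i : ℤ) = N ∧ m = ∏ i, y i} :=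
      ⟨z, fun i => ⟨(hz i).1, (hz i).2.trans (hy i).2⟩, by exact_mod_cast hzN, rfl⟩
    exact (Nat.sInf_le hmem).trans ((Finset.prod_le_prod' fun i _ => (hz i).2).trans hm)

/-! ### Lifting and dividing coefficients without raising the degree. -/

namespace MvPolynomial

open Finset

variable {σ R S : Type*} [CommRing R] [CommRing S]

theorem exists_map_eq_totalDegree_le {φ : R →+* S} (hφ : Function.Surjective φ)
    (p : MvPolynomial σ S) :
    ∃ P : MvPolynomial σ R, map φ P = p ∧ P.totalDegree ≤ p.totalDegree := by
  choose ψ hψ using hφ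
  refine ⟨∑ m ∈ p.support, monomial m (ψ (coeff m p)), ?_, totalDegree_finsetSum_le fun m hm => ?_⟩
  · simp only [map_sum, map_monomial, hψ]
    exact support_sum_monomial_coeff p
  · exact (totalDegree_monomial_le m _).trans (le_totalDegree hm)

theorem exists_eq_C_mul_totalDegree_le {a : R} {p : MvPolynomial σ R}
    (hp : ∀ m, a ∣ coeff m p) :
    ∃ P : MvPolynomial σ R, p = C a * P ∧ P.totalDegree ≤ p.totalDegree := by
  choose c hc using hp
  refine ⟨∑ m ∈ p.support, monomial m (c m), ?_, totalDegree_finsetSum_le fun m hm => ?_⟩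
  · simp only [mul_sum, C_mul_monomial, ← hc]
    exact (support_sum_monomial_coeff p).symm
  · exact (totalDegree_monomial_le m _).trans (le_totalDegree hm)

theorem totalDegree_prod_sub_C_le {ι : Type*} (s : Finset ι) (c : ι → R) (f : MvPolynomial σ R) :
    (∏ i ∈ s, (f - C (c i))).totalDegree ≤ #s * f.totalDegree := by
  refine (totalDegree_finsetProd _ _).trans ?_
  rw [← smul_eq_mul]
  exact sum_le_card_nsmul _ _ _ fun i _ => totalDegree_sub_C_le _ _

theorem totalDegree_map_le' (φ : R →+* S) (f : MvPolynomial σ R) :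
    (map φ f).totalDegree ≤ f.totalDegree :=
  Finset.sup_mono (support_map_subset φ f)

theorem eval_comp_map (φ : R →+* S) (x : σ → R) (f : MvPolynomial σ R) :
    eval (φ ∘ x) (map φ f) = φ (eval x f) := by
  rw [eval_map]
  exact (eval₂_comp φ x f).symm

end MvPolynomial

/-! ### Division by a generator of the maximal ideal. -/

namespace IsLocalRing

open Finset MvPolynomial

variable {R : Type*} [CommRing R] [IsLocalRing R]

/-- Otherwise `y = π ^ k * u` with `u` a unit and `k < w`. Then `π ^ (k + 1)` is killed by a unit of
the form `u - π ^ (d + 1) * z`, which forces `𝔭 ^ w = 0`. -/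
theorem mem_maximalIdeal_pow_of_mul_mem {π y : R} {w : ℕ}
    (hπ : maximalIdeal R = Ideal.span {π}) (hw : maximalIdeal R ^ w ≠ ⊥)
    (hy : π * y ∈ maximalIdeal R ^ (w + 1)) : y ∈ maximalIdeal R ^ w := by
  classical
  by_contra hyw
  have hex : ∃ w, y ∉ maximalIdeal R ^ w := ⟨w, hyw⟩
  obtain ⟨k, hk⟩ : ∃ k, Nat.find hex = k + 1 := Nat.exists_eq_succ_of_ne_zero fun h0 => by
    have := Nat.find_spec hex
    rw [h0] at this
    simp at this
  have hk1 : y ∉ maximalIdeal R ^ (k + 1) := hk ▸ Nat.find_spec hex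
  have hk0 : y ∈ maximalIdeal R ^ k := not_not.1 (Nat.find_min hex (by omega))
  have hkw : k + 1 ≤ w := hk ▸ Nat.find_min' hex hyw
  rw [hπ, Ideal.span_singleton_pow, Ideal.mem_span_singleton] at hk1 hk0 hy
  obtain ⟨u, rfl⟩ := hk0
  obtain ⟨z, hz⟩ := hy
  have hu : IsUnit u := by
    by_contra hu
    have : u ∈ maximalIdeal R := hu
    rw [hπ, Ideal.mem_span_singleton] at this
    exact hk1 (pow_succ π k ▸ mul_dvd_mul_left _ this)
  obtain ⟨d, rfl⟩ := Nat.exists_eq_add_of_le hkw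
  have hunit : IsUnit (u - π ^ (d + 1) * z) := by
    refine (residue_ne_zero_iff_isUnit _).1 ?_
    have h0 : residue R π = 0 := (residue_eq_zero_iff π).2 (hπ ▸ Ideal.mem_span_singleton_self π)
    rw [map_sub, map_mul, map_pow, h0, zero_pow (by omega), zero_mul, sub_zero]
    exact (residue_ne_zero_iff_isUnit u).2 hu
  have hzero : π ^ (k + 1) = 0 := by
    refine hunit.mul_left_eq_zero.1 ?_
    rw [mul_sub, sub_eq_zero]
    calc π ^ (k + 1) * u = π * (π ^ k * u) := by ring
      _ = π ^ (k + 1) * (π ^ (d + 1) * z) := by rw [hz]; ring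
  refine hw ?_
  rw [hπ, Ideal.span_singleton_pow, Ideal.span_singleton_eq_bot, pow_add, hzero, zero_mul]

theorem _root_.PairwiseIncongruent.injOn_residue {A : Finset R}
    (hA : PairwiseIncongruent A (maximalIdeal R)) : Set.InjOn (residue R) A := by
  intro x hx y hy hxy
  by_contra hne
  exact hA x hx y hy hne ((residue_eq_zero_iff _).1 (by rw [map_sub, hxy, sub_self]))

/-- A polynomial function on a grid with values in the maximal ideal `(π)` is `π` times a
polynomial function of no larger degree. -/
theorem exists_eval_eq_mul_eval {σ : Type*} [Fintype σ] {π : R}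
    (hπ : maximalIdeal R = Ideal.span {π}) {A : σ → Finset R} (hA : ∀ i, (A i).Nonempty)
    (hA_inc : ∀ i, PairwiseIncongruent (A i) (maximalIdeal R)) (f : MvPolynomial σ R)
    (hf : ∀ x : σ → R, (∀ i, x i ∈ A i) → eval x f ∈ maximalIdeal R) :
    ∃ g : MvPolynomial σ R, g.totalDegree ≤ f.totalDegree ∧
      ∀ x : σ → R, (∀ i, x i ∈ A i) → eval x f = π * eval x g := by
  classical
  obtain ⟨h, hdeg, hsum⟩ := exists_eq_sum_of_eval_eq_zero_on_grid
    (fun i => (A i).image (residue R)) (fun i => (hA i).image _) (map (residue R) f) (by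
      intro x hx
      choose y hyA hyx using fun i => mem_image.1 (hx i)
      obtain rfl : residue R ∘ y = x := funext hyx
      rw [eval_comp_map, residue_eq_zero_iff]
      exact hf y hyA)
  choose H hHmap hHdeg using fun i =>
    exists_map_eq_totalDegree_le (residue_surjective (R := R)) (h i)
  have hcard (i : σ) : #((A i).image (residue R)) = #(A i) :=
    card_image_of_injOn (hA_inc i).injOn_residue
  -- A lift of `0` may be a nonzero constant, and its product with the linear factors could exceed
  -- the degree of `f`; hence the explicit `0`.
  let G : σ → MvPolynomial σ R := fun i => if h i = 0 then 0 else H i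
  have hGmap (i : σ) : map (residue R) (G i) = h i := by
    by_cases h0 : h i = 0
    · simp [G, h0]
    · simpa [G, h0] using hHmap i
  have hGdeg (i : σ) : (G i * ∏ a ∈ A i, (X i - C a)).totalDegree ≤ f.totalDegree := by
    by_cases h0 : h i = 0
    · simp [G, h0]
    · have h1 := (hdeg i).resolve_left h0
      rw [hcard] at h1
      have h2 := totalDegree_prod_sub_C_le (A i) id (X i : MvPolynomial σ R)
      rw [totalDegree_X, mul_one] at h2
      simp only [G, h0, if_false]
      exact (totalDegree_mul _ _).trans ((add_le_add (hHdeg i) h2).trans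
        (h1.trans (totalDegree_map_le' _ _)))
  have hmap : map (residue R) (f - ∑ i, G i * ∏ a ∈ A i, (X i - C a)) = 0 := by
    rw [map_sub, map_sum, sub_eq_zero]
    conv_lhs => rw [hsum]
    refine sum_congr rfl fun i _ => ?_
    rw [map_mul, hGmap, prod_image (hA_inc i).injOn_residue]
    simp [map_prod]
  -- The subtracted sum vanishes on the grid, and what remains has all coefficients in `(π)`.
  obtain ⟨g, hg, hgdeg⟩ := exists_eq_C_mul_totalDegree_le (a := π)
    (p := f - ∑ i, G i * ∏ a ∈ A i, (X i - C a)) (fun m => by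
      rw [← Ideal.mem_span_singleton, ← hπ, ← residue_eq_zero_iff, ← coeff_map, hmap, coeff_zero])
  refine ⟨g, hgdeg.trans ((totalDegree_sub _ _).trans
    (max_le le_rfl (totalDegree_finsetSum_le fun i _ => hGdeg i))), fun x hx => ?_⟩
  have := congrArg (eval x) hg
  rw [map_mul, eval_C, map_sub, map_sum, sum_eq_zero, sub_zero] at this
  · exact this
  · intro i _
    rw [map_mul, map_prod, prod_eq_zero (hx i) (by simp), mul_zero]

theorem exists_section_residue {B : Finset R} (hB : PairwiseIncongruent B (maximalIdeal R)) :
    ∃ ρ : ResidueField R → R, (∀ s, residue R (ρ s) = s) ∧ ∀ b ∈ B, ρ (residue R b) = b := by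
  classical
  have (s : ResidueField R) : ∃ x, residue R x = s ∧ ∀ b ∈ B, residue R b = s → x = b := by
    by_cases h : ∃ b ∈ B, residue R b = s
    · obtain ⟨b, hb, hbs⟩ := h
      exact ⟨b, hbs, fun c hc hcs => hB.injOn_residue hb hc (hbs.trans hcs.symm)⟩
    · obtain ⟨x, hx⟩ := residue_surjective s
      exact ⟨x, hx, fun b hb hbs => (h ⟨b, hb, hbs⟩).elim⟩
  choose ρ h1 h2 using this
  exact ⟨ρ, h1, fun b hb => h2 _ b hb rfl⟩

/-! ### Indicator polynomials over the residue field. -/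

section Indicator

variable [Fintype (ResidueField R)]

/-- All factors except the one at `s = residue R u` are units, and when `u` reduces into the image
of `B` that one is `u - b` with `b ∈ B`. -/
theorem memMod_pow_succ_iff [DecidableEq (ResidueField R)] {B : Finset R}
    {ρ : ResidueField R → R} (hρ : ∀ s, residue R (ρ s) = s)
    (hρB : ∀ b ∈ B, ρ (residue R b) = b) (w : ℕ) (u : R) :
    MemMod u B (maximalIdeal R ^ (w + 1)) ↔
      residue R u ∈ B.image (residue R) ∧ ∏ s, (u - ρ s) ∈ maximalIdeal R ^ (w + 1) := by
  constructor
  · rintro ⟨b, hb, hub⟩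
    have hres : residue R u = residue R b := by
      rw [← sub_eq_zero, ← map_sub, residue_eq_zero_iff]
      exact Ideal.pow_le_self (Nat.succ_ne_zero w) hub
    refine ⟨hres ▸ mem_image_of_mem _ hb, ?_⟩
    rw [← mul_prod_erase univ _ (mem_univ (residue R b)), hρB b hb]
    exact Ideal.mul_mem_right _ _ hub
  · rintro ⟨hu, hprod⟩
    obtain ⟨b, hb, hbu⟩ := mem_image.1 hu
    refine ⟨b, hb, ?_⟩
    rw [← mul_prod_erase univ _ (mem_univ (residue R b)), hρB b hb] at hprod
    refine (Ideal.mul_unit_mem_iff_mem _ ?_).1 hprod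
    rw [← residue_ne_zero_iff_isUnit, map_prod, prod_ne_zero_iff]
    intro s hs
    rw [map_sub, hρ, sub_ne_zero, ← hbu]
    exact (ne_of_mem_erase hs).symm

variable {σ : Type*} [Fintype σ] {π : R} {A : σ → Finset R}

/-- The inductive step. After division by `π` only membership in `𝔭 ^ w` remains, so `hpow` concerns
the target `{0}` alone while `B` stays arbitrary. -/
theorem exists_eval_ne_zero_iff_memMod_of_pow (hπ : maximalIdeal R = Ideal.span {π})
    (hA : ∀ i, (A i).Nonempty) (hA_inc : ∀ i, PairwiseIncongruent (A i) (maximalIdeal R))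
    {w : ℕ} (hw : maximalIdeal R ^ w ≠ ⊥)
    (hpow : ∀ f : MvPolynomial σ R, ∃ P : MvPolynomial σ (ResidueField R),
      P.totalDegree ≤ (Fintype.card (ResidueField R) ^ w - 1) * f.totalDegree ∧
      ∀ x : σ → R, (∀ i, x i ∈ A i) →
        (eval (residue R ∘ x) P ≠ 0 ↔ eval x f ∈ maximalIdeal R ^ w))
    {B : Finset R} (hB : PairwiseIncongruent B (maximalIdeal R)) (f : MvPolynomial σ R) :
    ∃ P : MvPolynomial σ (ResidueField R),
      P.totalDegree ≤ (Fintype.card (ResidueField R) ^ (w + 1) - #B) * f.totalDegree ∧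
      ∀ x : σ → R, (∀ i, x i ∈ A i) →
        (eval (residue R ∘ x) P ≠ 0 ↔ MemMod (eval x f) B (maximalIdeal R ^ (w + 1))) := by
  classical
  obtain ⟨ρ, hρ, hρB⟩ := exists_section_residue hB
  obtain ⟨g, hgdeg, hg⟩ := exists_eval_eq_mul_eval hπ hA hA_inc (∏ s, (f - C (ρ s))) (by
    intro x _
    rw [← residue_eq_zero_iff, map_prod, map_prod]
    exact prod_eq_zero (mem_univ (residue R (eval x f))) (by simp [hρ]))
  obtain ⟨P, hPdeg, hP⟩ := hpow g
  have hcard : #(B.image (residue R)) = #B := card_image_of_injOn hB.injOn_residue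
  have hBq : #B ≤ Fintype.card (ResidueField R) := hcard ▸ card_le_univ _
  set q := Fintype.card (ResidueField R) with hq
  refine ⟨(∏ s ∈ (B.image (residue R))ᶜ, (map (residue R) f - C s)) * P, ?_, fun x hx => ?_⟩
  · have h1 := totalDegree_prod_sub_C_le (B.image (residue R))ᶜ id (map (residue R) f)
    rw [card_compl, hcard, ← hq] at h1
    have h2 := totalDegree_prod_sub_C_le univ ρ f
    rw [card_univ, ← hq] at h2
    have hqw : 1 ≤ q ^ w := Nat.one_le_pow _ _ Fintype.card_pos
    calc _ ≤ (q - #B) * f.totalDegree + (q ^ w - 1) * (q * f.totalDegree) :=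
          (totalDegree_mul _ _).trans (add_le_add
            (h1.trans (Nat.mul_le_mul_left _ (totalDegree_map_le' _ _)))
            (hPdeg.trans (Nat.mul_le_mul_left _ (hgdeg.trans h2))))
      _ = (q - #B + (q ^ w - 1) * q) * f.totalDegree := by ring
      _ = (q ^ (w + 1) - #B) * f.totalDegree := by
          congr 1
          have : q ≤ q ^ w * q := Nat.le_mul_of_pos_left q hqw
          rw [Nat.sub_mul, one_mul, pow_succ]
          omega
  · rw [map_mul, mul_ne_zero_iff, hP x hx, memMod_pow_succ_iff hρ hρB w]
    refine and_congr ?_ ?_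
    · rw [map_prod, prod_ne_zero_iff]
      simp only [map_sub, eval_comp_map, eval_C, sub_ne_zero, mem_compl]
      exact ⟨fun h => by_contra fun hn => h _ hn rfl, fun h s hs hse => hs (hse ▸ h)⟩
    · have hprod : ∏ s, (eval x f - ρ s) = π * eval x g := by
        rw [← hg x hx, map_prod]
        simp
      rw [hprod]
      refine ⟨fun h => ?_, mem_maximalIdeal_pow_of_mul_mem hπ hw⟩
      rw [pow_succ']
      exact Ideal.mul_mem_mul (hπ ▸ Ideal.mem_span_singleton_self π) h

theorem exists_eval_ne_zero_iff_mem_pow (hπ : maximalIdeal R = Ideal.span {π})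
    (hA : ∀ i, (A i).Nonempty) (hA_inc : ∀ i, PairwiseIncongruent (A i) (maximalIdeal R))
    {v : ℕ} (hv : maximalIdeal R ^ (v - 1) ≠ ⊥) {w : ℕ} (hw : w ≤ v) (f : MvPolynomial σ R) :
    ∃ P : MvPolynomial σ (ResidueField R),
      P.totalDegree ≤ (Fintype.card (ResidueField R) ^ w - 1) * f.totalDegree ∧
      ∀ x : σ → R, (∀ i, x i ∈ A i) →
        (eval (residue R ∘ x) P ≠ 0 ↔ eval x f ∈ maximalIdeal R ^ w) := by
  induction w generalizing f with
  -- The condition is empty and the degree factor is `q ^ 0 - 1 = 0`.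
  | zero => exact ⟨1, by simp⟩
  | succ w ih =>
    have hw' : maximalIdeal R ^ w ≠ ⊥ := fun h =>
      hv (eq_bot_iff.2 (h ▸ Ideal.pow_le_pow_right (by omega)))
    simpa [MemMod] using exists_eval_ne_zero_iff_memMod_of_pow hπ hA hA_inc hw'
      (ih (by omega)) (B := {0}) (by simp [PairwiseIncongruent]) f

/-- On a grid of pairwise incongruent elements, the condition `f(x) ∈ B (mod 𝔭 ^ w)` is detected
by a polynomial of degree at most `(q ^ w - #B) * deg f` over the residue field. -/
theorem exists_eval_ne_zero_iff_memMod (hπ : maximalIdeal R = Ideal.span {π})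
    (hA : ∀ i, (A i).Nonempty) (hA_inc : ∀ i, PairwiseIncongruent (A i) (maximalIdeal R))
    {v : ℕ} (hv : maximalIdeal R ^ (v - 1) ≠ ⊥) {w : ℕ} (hw0 : 1 ≤ w) (hw : w ≤ v)
    {B : Finset R} (hB : PairwiseIncongruent B (maximalIdeal R)) (f : MvPolynomial σ R) :
    ∃ P : MvPolynomial σ (ResidueField R),
      P.totalDegree ≤ (Fintype.card (ResidueField R) ^ w - #B) * f.totalDegree ∧
      ∀ x : σ → R, (∀ i, x i ∈ A i) →
        (eval (residue R ∘ x) P ≠ 0 ↔ MemMod (eval x f) B (maximalIdeal R ^ w)) := by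
  obtain ⟨w, rfl⟩ := Nat.exists_eq_add_of_le' hw0
  have hw' : maximalIdeal R ^ w ≠ ⊥ := fun h =>
    hv (eq_bot_iff.2 (h ▸ Ideal.pow_le_pow_right (by omega)))
  exact exists_eval_ne_zero_iff_memMod_of_pow hπ hA hA_inc hw'
    (exists_eval_ne_zero_iff_mem_pow hπ hA hA_inc hv (by omega)) hB f

theorem _root_.PairwiseIncongruent.card_le {B : Finset R}
    (hB : PairwiseIncongruent B (maximalIdeal R)) :
    #B ≤ Fintype.card (ResidueField R) := by
  classical
  exact card_image_of_injOn hB.injOn_residue ▸ card_le_univ (B.image (residue R))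

end Indicator

end IsLocalRing

/-! ### Assembly over the residue field. -/

theorem theorem1p5 {R : Type*} [CommRing R] [IsLocalRing R] [IsPrincipalIdealRing R] [Finite R]
    (v q n r : ℕ) (hv : 0 < v)
    (hv_ne : IsLocalRing.maximalIdeal R ^ (v - 1) ≠ ⊥)
    (hv_eq : IsLocalRing.maximalIdeal R ^ v = ⊥)
    (hq : Nat.card (IsLocalRing.ResidueField R) = q)
    (hn : 0 < n) (hr : 0 < r)
    (w : Fin r → ℕ) (hw : ∀ j, 1 ≤ w j ∧ w j ≤ v)
    (A : Fin n → Finset R) (B : Fin r → Finset R)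
    (hA : ∀ i, (A i).Nonempty) (hB : ∀ j, (B j).Nonempty)
    (hA_inc : ∀ i, PairwiseIncongruent (A i) (IsLocalRing.maximalIdeal R))
    (hB_inc : ∀ j, PairwiseIncongruent (B j) (IsLocalRing.maximalIdeal R))
    (f : Fin r → MvPolynomial (Fin n) R) :
    restrictedSolutions A B w f = ∅ ∨
      frakM (fun i => (A i).card)
          (∑ i, ((A i).card : ℤ)
            - ∑ j, ((q : ℤ) ^ w j - ((B j).card : ℤ)) * ((f j).totalDegree : ℤ))
        ≤ (restrictedSolutions A B w f).ncard := by
  classical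
  have := Finite.of_surjective _ (IsLocalRing.residue_surjective (R := R))
  have := Fintype.ofFinite (IsLocalRing.ResidueField R)
  obtain rfl : Fintype.card (IsLocalRing.ResidueField R) = q := by
    rw [← hq, Nat.card_eq_fintype_card]
  rw [or_iff_not_imp_left, ← ne_eq, ← Set.nonempty_iff_ne_empty]
  rintro ⟨x₀, hx₀⟩
  obtain ⟨π, hπ⟩ := (IsPrincipalIdealRing.principal (IsLocalRing.maximalIdeal R)).principal
  choose P hPdeg hP using fun j => IsLocalRing.exists_eval_ne_zero_iff_memMod hπ hA hA_inc hv_ne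
    (hw j).1 (hw j).2 (hB_inc j) (f j)
  let ρ : (Fin n → R) → Fin n → IsLocalRing.ResidueField R := fun x => IsLocalRing.residue R ∘ x
  let A' : Fin n → Finset (IsLocalRing.ResidueField R) :=
    fun i => (A i).image (IsLocalRing.residue R)
  have hcard (i : Fin n) : (A' i).card = (A i).card :=
    Finset.card_image_of_injOn (hA_inc i).injOn_residue
  have hQ (x : Fin n → R) (hx : ∀ i, x i ∈ A i) :
      MvPolynomial.eval (ρ x) (∏ j, P j) ≠ 0 ↔ x ∈ restrictedSolutions A B w f := by
    rw [map_prod, Finset.prod_ne_zero_iff]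
    simp only [Finset.mem_univ, true_implies, hP _ x hx, ρ, restrictedSolutions, Set.mem_ofPred_eq,
      hx, implies_true, true_and]
  have hmem (x : Fin n → R) (hx : ∀ i, x i ∈ A i) : ρ x ∈ Fintype.piFinset A' :=
    Fintype.mem_piFinset.2 fun i => Finset.mem_image_of_mem _ (hx i)
  obtain ⟨y, hy, hsum, hprod⟩ := MvPolynomial.alon_furedi A' (∏ j, P j)
    ⟨ρ x₀, hmem x₀ hx₀.1, (hQ x₀ hx₀.1).2 hx₀⟩
  have hdeg : (∏ j, P j).totalDegree ≤
      ∑ j, (Fintype.card (IsLocalRing.ResidueField R) ^ w j - (B j).card) * (f j).totalDegree :=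
    (MvPolynomial.totalDegree_finsetProd _ _).trans (Finset.sum_le_sum fun j _ => hPdeg j)
  refine frakM_le_of_prod_le (y := y) (fun i => hcard i ▸ hy i) ?_ (hprod.trans ?_)
  · have hcast : ∑ j, ((Fintype.card (IsLocalRing.ResidueField R) : ℤ) ^ w j - ((B j).card : ℤ)) *
        ((f j).totalDegree : ℤ) = ((∑ j, (Fintype.card (IsLocalRing.ResidueField R) ^ w j -
          (B j).card) * (f j).totalDegree : ℕ) : ℤ) := by
      push_cast
      refine Finset.sum_congr rfl fun j _ => ?_
      -- The natural subtraction is not truncated: `#B ≤ q ≤ q ^ w`, the latter because `w j ≥ 1`.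
      rw [Nat.cast_sub ((hB_inc j).card_le.trans
        (Nat.le_self_pow (Nat.one_le_iff_ne_zero.1 (hw j).1) _)), Nat.cast_pow]
    rw [hcast, sub_le_iff_le_add, add_comm]
    simp only [hcard] at hsum
    exact_mod_cast hsum.trans (Nat.add_le_add_right hdeg _)
  · rw [← Set.ncard_coe_finset]
    -- Every nonvanishing point of the reduced grid is the reduction of a solution.
    refine (Set.ncard_le_ncard ?_ ((Set.toFinite _).image ρ)).trans
      (Set.ncard_image_le (Set.toFinite (restrictedSolutions A B w f)))
    intro z hz
    obtain ⟨hzA, hz0⟩ := Finset.mem_filter.1 (Finset.mem_coe.1 hz)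
    choose x hxA hxz using fun i => Finset.mem_image.1 (Fintype.mem_piFinset.1 hzA i)
    obtain rfl : ρ x = z := funext hxz
    exact ⟨x, (hQ x hxA).1 hz0, rfl⟩
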